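/- Let $N\ge 1$, let $B=[b_{ij}]\in\mathbb{R}^{N\times N}$ be the adjacency matrix of an undirected signed graph, that is, $B=B^{\mathrm T}$ with $b_{ii}=0$ and entries of arbitrary sign, let $\sigma_1,\dots,\sigma_N>0$ and $\Sigma=\mathrm{diag}\{\sigma_1,\dots,\sigma_N\}$. Consider the opinion dynamics with stubborn neutrals $$\dot x_i=x_i^2\Big(-\sigma_i x_i+\sum_{j=1}^N b_{ij}x_j\Big),\qquad i=1,\dots,N,\quad t\ge 0,\qquad x(0)\in[-1,1]^N .$$ A real square matrix $A$ is eventually positive if there is a positive integer $k_0$ such that all entries of $A^k$ are positive for all $k\ge k_0$; $\rho(A)$ is its spectral radius; vector inequalities are strict in every coordinate. Suppose that one of the following holds. Assumption 1: $B$ is eventually positive and $\sigma_i=\sigma_j\ge\rho(B)$ for all $i,j$. In this case put $M=B$ and $s=\sigma_1=\dots=\sigma_N$. Assumption 2: $B$ is not eventually positive, and for some real $d$ the matrix $C=B+dI-\Sigma$ is eventually positive with $d\ge\rho(C)$. In this case put $M=C$ and $s=d$. Then for every $x(0)\in[-1,1]^N$ a solution $x(t)$ exists for all $t\ge0$, $M$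 has an eigenvector with positive entries for the eigenvalue $\rho(M)$, and, for each such eigenvector $v_r$ and each solution: If $s=\rho(M)$, then 1) if $x(0)>\mathbf 0$, then $\lim_{t\to\infty}x(t)=\alpha v_r$ for some $\alpha>0$, and $\alpha\in\big(0,\frac1{\|v_r\|_\infty}\big]$ if the opinions satisfy $x(t)\in[-1,1]^N$ for all $t\ge0$; 2) if $x(0)<\mathbf 0$, then $\lim_{t\to\infty}x(t)=\alpha v_r$ for some $\alpha<0$, and $\alpha\in\big[-\frac1{\|v_r\|_\infty},0\big)$ if the opinions satisfy $x(t)\in[-1,1]^N$ for all $t\ge0$; 3) $\lim_{t\to\infty}x(t)=\mathbf 0$ for all other $x(0)\in[-1,1]^N$. If $s>\rho(M)$, then $\lim_{t\to\infty}x(t)=\mathbf 0$ for all $x(0)\in[-1,1]^N$. -/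

import Mathlib

open Filter Topology

namespace OpinionDynamics

variable {N : ℕ}

/-- A real square matrix is eventually positive if all its sufficiently high powers
are entrywise positive. -/
def EventuallyPositive (A : Matrix (Fin N) (Fin N) ℝ) : Prop :=
  ∃ k₀ : ℕ, 0 < k₀ ∧ ∀ k : ℕ, k₀ ≤ k → ∀ i j, 0 < (A ^ k) i j

/-- The spectral radius `ρ(A)` of a real square matrix: the maximal modulus of its
(complex) eigenvalues, as a real number. -/
noncomputable def rho (A : Matrix (Fin N) (Fin N) ℝ) : ℝ :=
  (spectralRadius ℂ (A.map (algebraMap ℝ ℂ))).toReal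

/-- `v` is a right positive eigenvector of `A`, i.e. an entrywise positive eigenvector
for the eigenvalue `ρ(A)`. -/
def IsRightPositiveEigenvector (A : Matrix (Fin N) (Fin N) ℝ) (v : Fin N → ℝ) : Prop :=
  (∀ i, 0 < v i) ∧ A.mulVec v = rho A • v

/-- The right-hand side of the opinion dynamics
`ẋᵢ = aᵢ(xᵢ) (-σᵢ xᵢ + ∑ⱼ bᵢⱼ xⱼ)` with susceptibility functions `aᵢ`. -/
def opinionField (a : Fin N → ℝ → ℝ) (B : Matrix (Fin N) (Fin N) ℝ) (σ : Fin N → ℝ)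
    (x : Fin N → ℝ) : Fin N → ℝ :=
  fun i => a i (x i) * (-σ i * x i + ∑ j, B i j * x j)

/-- The susceptibility functions `aᵢ(s) = s²` of the stubborn neutrals scenario,
that is, `A(x) = diag(x)²`. -/
def stubbornNeutrals : Fin N → ℝ → ℝ := fun _ s => s ^ 2

/-- `x` is a solution on `[0, ∞)` of the opinion dynamics in the stubborn neutrals scenario
(one-sided derivative at time `0`; the values of `x` at negative times are irrelevant). -/
def IsSolution (B : Matrix (Fin N) (Fin N) ℝ) (σ : Fin N → ℝ) (x : ℝ → Fin N → ℝ) : Prop :=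
  ∀ t : ℝ, 0 ≤ t →
    HasDerivWithinAt x (opinionField stubbornNeutrals B σ (x t)) (Set.Ici 0) t

/-- The cube `[-1, 1]^N` of admissible opinions. -/
def cube (N : ℕ) : Set (Fin N → ℝ) := {x | ∀ i, x i ∈ Set.Icc (-1 : ℝ) 1}

/-- `B` is eventually positive and `σᵢ = σⱼ ≥ ρ(B)` for all `i, j`. -/
def Assumption1 (B : Matrix (Fin N) (Fin N) ℝ) (σ : Fin N → ℝ) : Prop :=
  EventuallyPositive B ∧ (∀ i j, σ i = σ j) ∧ ∀ i, rho B ≤ σ i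

/-- The matrix `C = B + D`, where `D = d I - Σ`. Thus `B - Σ = C - d I`. -/
def shifted (B : Matrix (Fin N) (Fin N) ℝ) (σ : Fin N → ℝ) (d : ℝ) :
    Matrix (Fin N) (Fin N) ℝ :=
  B + (d • (1 : Matrix (Fin N) (Fin N) ℝ) - Matrix.diagonal σ)

/-- `B` is not eventually positive, `C = B + d I - Σ` is eventually positive, and
`d ≥ ρ(C)`. -/
def Assumption2 (B : Matrix (Fin N) (Fin N) ℝ) (σ : Fin N → ℝ) (d : ℝ) : Prop :=
  ¬ EventuallyPositive B ∧ EventuallyPositive (shifted B σ d) ∧ rho (shifted B σ d) ≤ d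

/-- From every initial state in the cube there is a solution for all times `t ≥ 0`. -/
def SolutionsExist (B : Matrix (Fin N) (Fin N) ℝ) (σ : Fin N → ℝ) : Prop :=
  ∀ x₀ ∈ cube N, ∃ x : ℝ → Fin N → ℝ, IsSolution B σ x ∧ x 0 = x₀

/-- The three convergence claims relative to the vector `v`. The norm of `Fin N → ℝ` is the
infinity norm. The outer bound on `α` is the one for opinions that stay in the cube. -/
def ConvergesToMultiples (B : Matrix (Fin N) (Fin N) ℝ) (σ : Fin N → ℝ) (v : Fin N → ℝ) :
    Prop :=
  ∀ x : ℝ → Fin N → ℝ, IsSolution B σ x → x 0 ∈ cube N →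
    ((∀ i, 0 < x 0 i) →
      ∃ α : ℝ, 0 < α ∧ ((∀ t : ℝ, 0 ≤ t → x t ∈ cube N) → α ≤ 1 / ‖v‖) ∧
        Tendsto x atTop (𝓝 (α • v))) ∧
    ((∀ i, x 0 i < 0) →
      ∃ α : ℝ, α < 0 ∧ ((∀ t : ℝ, 0 ≤ t → x t ∈ cube N) → -(1 / ‖v‖) ≤ α) ∧
        Tendsto x atTop (𝓝 (α • v))) ∧
    (¬ (∀ i, 0 < x 0 i) → ¬ (∀ i, x 0 i < 0) → Tendsto x atTop (𝓝 0))

/-- Every solution starting in the cube tends to `0`. -/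
def ConvergesToZero (B : Matrix (Fin N) (Fin N) ℝ) (σ : Fin N → ℝ) : Prop :=
  ∀ x : ℝ → Fin N → ℝ, IsSolution B σ x → x 0 ∈ cube N → Tendsto x atTop (𝓝 0)

end OpinionDynamics

open Filter Topology

namespace OpinionDynamics

variable {N : ℕ}

/-! With `W = s • 1 - M = Σ - B`, the dynamics read `ẋᵢ = -xᵢ² (W x)ᵢ`, and `W` is symmetric and
positive semidefinite because `s ≥ ρ(M)`. The energy `E = xᵀ W x` satisfies `Ė = -2 ∑ (xᵢ (W x)ᵢ)² ≤
-2 E² / N` by Cauchy–Schwarz, so `E → 0` (`tendsto_energy`). If `s > ρ(M)`, then `W` is positive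
definite and `x → 0`.

If `s = ρ(M)`, Perron–Frobenius shows that `E` vanishes only on the line through `v > 0`. The limit
on this line is singled out by the first integral `∑ vᵢ / xᵢ`: for a positive or negative start it
keeps `x(t)` from lying strictly above or strictly below one fixed multiple `a v`. For all other
starts the coordinates keep their signs, which gives the same with `a = 0` (`exists_interlacing`).
On vectors that are not of one strict sign `E` is coercive, so `‖x - a v‖² ≤ E / m → 0`.

These estimates survive a nonnegative time-dependent change of speed. They therefore bound the
solutions of a truncated field, which yields global existence. -/

/-! ### Spectral radius and Perron–Frobenius theory for symmetric matrices. -/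

open Matrix in
open scoped Matrix.Norms.L2Operator in
theorem rho_eq_norm {M : Matrix (Fin N) (Fin N) ℝ} (hM : M.IsSymm) :
    rho M = ‖M.map (algebraMap ℝ ℂ)‖ := by
  have hs : IsSelfAdjoint (M.map (algebraMap ℝ ℂ)) := by
    ext i j
    have := congrFun (congrFun hM i) j
    simp only [Matrix.transpose_apply] at this
    simp [Matrix.star_apply, this]
  rw [rho, hs.spectralRadius_eq_nnnorm]
  rfl

theorem rho_nonneg (M : Matrix (Fin N) (Fin N) ℝ) : 0 ≤ rho M := ENNReal.toReal_nonneg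

open Matrix in
open scoped Matrix.Norms.L2Operator in
theorem mulVec_dotProduct_self_le {M : Matrix (Fin N) (Fin N) ℝ} (hM : M.IsSymm)
    (x : Fin N → ℝ) : (M *ᵥ x) ⬝ᵥ (M *ᵥ x) ≤ rho M ^ 2 * (x ⬝ᵥ x) := by
  have h := Matrix.l2_opNorm_mulVec (M.map (algebraMap ℝ ℂ))
    (WithLp.toLp 2 (fun i => (x i : ℂ)))
  rw [← rho_eq_norm hM] at h
  have h2 := pow_le_pow_left₀ (norm_nonneg _) h 2
  rw [mul_pow, EuclideanSpace.norm_sq_eq, EuclideanSpace.norm_sq_eq] at h2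
  have e : ∀ i, ((M.map (algebraMap ℝ ℂ)) *ᵥ (fun i => (x i : ℂ))) i = ((M *ᵥ x) i : ℂ) := by
    intro i
    simp [Matrix.mulVec, dotProduct]
  have h3 : ∑ i, ‖((M.map (algebraMap ℝ ℂ)) *ᵥ (fun i => (x i : ℂ))) i‖ ^ 2
      ≤ rho M ^ 2 * ∑ i, ‖(x i : ℂ)‖ ^ 2 := h2
  simp only [e, Complex.norm_real, Real.norm_eq_abs, sq_abs] at h3
  simpa only [dotProduct, ← sq] using h3

open Matrix in
theorem pow_mulVec_dotProduct_self_le {M : Matrix (Fin N) (Fin N) ℝ} (hM : M.IsSymm)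
    (x : Fin N → ℝ) (k : ℕ) :
    ((M ^ k) *ᵥ x) ⬝ᵥ ((M ^ k) *ᵥ x) ≤ (rho M ^ k) ^ 2 * (x ⬝ᵥ x) := by
  induction k with
  | zero => simp
  | succ k ih =>
    rw [pow_succ', ← Matrix.mulVec_mulVec]
    refine (mulVec_dotProduct_self_le hM _).trans ?_
    calc _ ≤ rho M ^ 2 * ((rho M ^ k) ^ 2 * (x ⬝ᵥ x)) := by gcongr
      _ = _ := by ring

open Matrix in
theorem dotProduct_mulVec_le {M : Matrix (Fin N) (Fin N) ℝ} (hM : M.IsSymm)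
    (x : Fin N → ℝ) : x ⬝ᵥ (M *ᵥ x) ≤ rho M * (x ⬝ᵥ x) := by
  have h := mulVec_dotProduct_self_le hM x
  have hx : 0 ≤ x ⬝ᵥ x := Finset.sum_nonneg fun i _ => mul_self_nonneg _
  have hρ := rho_nonneg M
  have hcs : (x ⬝ᵥ (M *ᵥ x)) ^ 2 ≤ (x ⬝ᵥ x) * ((M *ᵥ x) ⬝ᵥ (M *ᵥ x)) := by
    have := Finset.sum_mul_sq_le_sq_mul_sq Finset.univ x (M *ᵥ x)
    simpa [dotProduct, sq] using this
  refine abs_le_of_sq_le_sq' ?_ (by positivity) |>.2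
  calc _ ≤ _ := hcs
    _ ≤ (x ⬝ᵥ x) * (rho M ^ 2 * (x ⬝ᵥ x)) := by gcongr
    _ = _ := by ring

-- Expanding `‖M x - ρ x‖²` and inserting the hypothesis leaves `‖M x‖² - ρ² ‖x‖² ≤ 0`.
open Matrix in
theorem mulVec_eq_of_dotProduct_mulVec_eq {M : Matrix (Fin N) (Fin N) ℝ} (hM : M.IsSymm)
    {x : Fin N → ℝ} (hx : x ⬝ᵥ (M *ᵥ x) = rho M * (x ⬝ᵥ x)) : M *ᵥ x = rho M • x := by
  have h := mulVec_dotProduct_self_le hM x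
  have key : (M *ᵥ x - rho M • x) ⬝ᵥ (M *ᵥ x - rho M • x) ≤ 0 := by
    have : (M *ᵥ x - rho M • x) ⬝ᵥ (M *ᵥ x - rho M • x)
        = (M *ᵥ x) ⬝ᵥ (M *ᵥ x) - 2 * rho M * (x ⬝ᵥ (M *ᵥ x)) + rho M ^ 2 * (x ⬝ᵥ x) := by
      simp only [sub_dotProduct, dotProduct_sub, smul_dotProduct, dotProduct_smul, smul_eq_mul,
        dotProduct_comm (M *ᵥ x) x]
      ring
    rw [this, hx]
    linarith
  have h0 : 0 ≤ (M *ᵥ x - rho M • x) ⬝ᵥ (M *ᵥ x - rho M • x) :=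
    Finset.sum_nonneg fun i _ => mul_self_nonneg _
  exact sub_eq_zero.1 (dotProduct_self_eq_zero.1 (le_antisymm key h0))

open Matrix in
theorem pow_mulVec_of_mulVec_eq {R : Type*} [CommRing R] {M : Matrix (Fin N) (Fin N) R}
    {c : R} {x : Fin N → R} (h : M *ᵥ x = c • x) (k : ℕ) : (M ^ k) *ᵥ x = c ^ k • x := by
  induction k with
  | zero => simp
  | succ k ih => rw [pow_succ', ← Matrix.mulVec_mulVec, ih, mulVec_smul, h, smul_smul, pow_succ]

open Matrix in
theorem mulVec_pos_of_entries_pos {A : Matrix (Fin N) (Fin N) ℝ} (hA : ∀ i j, 0 < A i j)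
    {w : Fin N → ℝ} (hw : ∀ i, 0 ≤ w i) (hw0 : w ≠ 0) (i : Fin N) : 0 < (A *ᵥ w) i := by
  obtain ⟨j, hj⟩ := Function.ne_iff.1 hw0
  refine Finset.sum_pos' (fun k _ => mul_nonneg (hA i k).le (hw k)) ⟨j, Finset.mem_univ _, ?_⟩
  exact mul_pos (hA i j) (lt_of_le_of_ne (hw j) (Ne.symm hj))

open Matrix in
theorem exists_complex_eigenvector [NeZero N] (M : Matrix (Fin N) (Fin N) ℝ) :
    ∃ (μ : ℂ) (u : Fin N → ℂ), ‖μ‖ = rho M ∧ u ≠ 0 ∧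
      (M.map (algebraMap ℝ ℂ)) *ᵥ u = μ • u := by
  obtain ⟨μ, hμ, hn⟩ : ∃ μ ∈ spectrum ℂ (M.map (algebraMap ℝ ℂ)),
      (‖μ‖₊ : ENNReal) = spectralRadius ℂ (M.map (algebraMap ℝ ℂ)) := by
    open scoped Matrix.Norms.L2Operator in
    exact spectrum.exists_nnnorm_eq_spectralRadius _
  rw [← Matrix.spectrum_toLin', ← Module.End.hasEigenvalue_iff_mem_spectrum] at hμ
  obtain ⟨u, hu⟩ := hμ.exists_hasEigenvector
  refine ⟨μ, u, ?_, hu.2, ?_⟩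
  · rw [rho, ← hn]; rfl
  · simpa using hu.apply_eq_smul

open Matrix in
/-- The Perron–Frobenius theorem for symmetric eventually positive matrices: existence. -/
theorem exists_isRightPositiveEigenvector [NeZero N] {M : Matrix (Fin N) (Fin N) ℝ}
    (hM : M.IsSymm) (hpos : EventuallyPositive M) : ∃ v, IsRightPositiveEigenvector M v := by
  obtain ⟨k₀, -, hk⟩ := hpos
  obtain ⟨μ, u, hμ, hu0, hu⟩ := exists_complex_eigenvector M
  -- The moduli of a complex eigenvector for an eigenvalue of maximal modulus are the candidate.
  set w : Fin N → ℝ := fun i => ‖u i‖ with hw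
  have hw0 : w ≠ 0 := fun h => hu0 (funext fun i => norm_eq_zero.1 (congrFun h i))
  have hwn : ∀ i, 0 ≤ w i := fun i => norm_nonneg _
  have hle : ∀ k, k₀ ≤ k → ∀ i, rho M ^ k * w i ≤ ((M ^ k) *ᵥ w) i := by
    intro k hkk i
    have h1 := congrFun (pow_mulVec_of_mulVec_eq hu k) i
    have h2 : ‖(μ ^ k • u) i‖ = rho M ^ k * w i := by simp [hμ, hw]
    rw [← h2, ← h1]
    have h3 : (M.map (algebraMap ℝ ℂ)) ^ k = (M ^ k).map (algebraMap ℝ ℂ) :=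
      (Matrix.map_pow M (algebraMap ℝ ℂ) k).symm
    rw [h3]
    refine (norm_sum_le Finset.univ fun j => (M ^ k).map (algebraMap ℝ ℂ) i j * u j).trans
      (le_of_eq (Finset.sum_congr rfl fun j _ => ?_))
    simp [hw, abs_of_pos (hk k hkk i j)]
  -- Symmetry bounds the Euclidean norm of `M ^ k w` by that of `ρ ^ k w`, so the coordinatewise
  -- inequalities `hle` are all equalities.
  have heq : ∀ k, k₀ ≤ k → (M ^ k) *ᵥ w = rho M ^ k • w := by
    intro k hkk
    have hρ := rho_nonneg M
    have hterm : ∀ i ∈ Finset.univ, (rho M ^ k * w i) * (rho M ^ k * w i)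
        ≤ ((M ^ k) *ᵥ w) i * ((M ^ k) *ᵥ w) i := fun i _ =>
      mul_self_le_mul_self (mul_nonneg (by positivity) (hwn i)) (hle k hkk i)
    have hsum : ∑ i, ((M ^ k) *ᵥ w) i * ((M ^ k) *ᵥ w) i
        ≤ ∑ i, (rho M ^ k * w i) * (rho M ^ k * w i) := by
      refine (pow_mulVec_dotProduct_self_le hM w k).trans (le_of_eq ?_)
      simp only [dotProduct, Finset.mul_sum]
      exact Finset.sum_congr rfl fun i _ => by ring
    have := (Finset.sum_eq_sum_iff_of_le hterm).1
      (le_antisymm (Finset.sum_le_sum hterm) hsum)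
    funext i
    have hi := this i (Finset.mem_univ i)
    have := (mul_self_inj (mul_nonneg (by positivity) (hwn i))
      ((mul_nonneg (by positivity) (hwn i)).trans (hle k hkk i))).1 hi
    simpa using this.symm
  have hpw : ∀ i, 0 < rho M ^ k₀ * w i := fun i => by
    have := mulVec_pos_of_entries_pos (hk k₀ le_rfl) hwn hw0 i
    rwa [heq k₀ le_rfl] at this
  have hρ0 : rho M ^ k₀ ≠ 0 := fun h => by simpa [h] using hpw 0
  refine ⟨w, fun i => ?_, ?_⟩
  · exact lt_of_le_of_ne (hwn i) fun h => by simpa [← h] using hpw i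
  -- Comparing the exponents `k₀ + 1` and `k₀` cancels `ρ ^ k₀` and leaves `M w = ρ w`.
  · have h1 := heq (k₀ + 1) (Nat.le_succ _)
    rw [pow_succ', ← Matrix.mulVec_mulVec, heq k₀ le_rfl, mulVec_smul, pow_succ,
      mul_smul] at h1
    exact smul_right_injective _ hρ0 h1

open Matrix in
/-- The Perron–Frobenius theorem for eventually positive matrices: geometric simplicity. -/
theorem IsRightPositiveEigenvector.eq_smul [NeZero N] {M : Matrix (Fin N) (Fin N) ℝ}
    (hpos : EventuallyPositive M) {v : Fin N → ℝ} (hv : IsRightPositiveEigenvector M v)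
    {u : Fin N → ℝ} (hu : M *ᵥ u = rho M • u) : ∃ c : ℝ, u = c • v := by
  obtain ⟨k₀, -, hk⟩ := hpos
  -- With `c` the least ratio, `u - c v` is nonnegative and vanishes at `i`. Were it nonzero, a
  -- positive power of `M` would make its `i`-th coordinate positive.
  obtain ⟨i, hi⟩ := Finite.exists_min fun i => u i / v i
  refine ⟨u i / v i, ?_⟩
  by_contra hne
  have hw : ∀ j, 0 ≤ (u - (u i / v i) • v) j := fun j => by
    have := (le_div_iff₀ (hv.1 j)).1 (hi j)
    simpa using this
  have hm : M *ᵥ (u - (u i / v i) • v) = rho M • (u - (u i / v i) • v) := by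
    rw [mulVec_sub, mulVec_smul, hu, hv.2, smul_sub, smul_comm]
  have := mulVec_pos_of_entries_pos (hk k₀ le_rfl) hw (sub_ne_zero.2 hne) i
  rw [pow_mulVec_of_mulVec_eq hm] at this
  simp [div_mul_cancel₀ _ (hv.1 i).ne'] at this

/-! ### Energy decay, sign preservation and the first integral. -/

open Matrix in
/-- The quadratic form of `W`, a Lyapunov function of the dynamics. -/
def energy (W : Matrix (Fin N) (Fin N) ℝ) (x : Fin N → ℝ) : ℝ := x ⬝ᵥ (W *ᵥ x)

open Matrix in
/-- `x` solves `ẋᵢ = -φ(t) xᵢ² (W x)ᵢ` on `[0, ∞)`, where `φ ≥ 0` is a continuous change of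
speed. -/
structure IsScaledSolution (W : Matrix (Fin N) (Fin N) ℝ) (φ : ℝ → ℝ) (x : ℝ → Fin N → ℝ) :
    Prop where
  continuousOn_speed : ContinuousOn φ (Set.Ici 0)
  speed_nonneg : ∀ t, 0 ≤ t → 0 ≤ φ t
  hasDeriv : ∀ t, 0 ≤ t →
    HasDerivWithinAt x (fun i => φ t * -(x t i ^ 2 * (W *ᵥ x t) i)) (Set.Ici 0) t

theorem antitoneOn_of_hasDerivWithinAt {D : Set ℝ} (hD : Convex ℝ D) {f f' : ℝ → ℝ}
    (h : ∀ t ∈ D, HasDerivWithinAt f (f' t) D t) (hf' : ∀ t ∈ D, f' t ≤ 0) : AntitoneOn f D :=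
  antitoneOn_of_hasDerivWithinAt_nonpos hD (fun t ht => (h t ht).continuousWithinAt)
    (fun t ht => (h t (interior_subset ht)).mono interior_subset)
    (fun t ht => hf' t (interior_subset ht))

theorem eq_of_hasDerivWithinAt_zero {f : ℝ → ℝ}
    (h : ∀ t, 0 ≤ t → HasDerivWithinAt f 0 (Set.Ici 0) t) {t : ℝ} (ht : 0 ≤ t) : f t = f 0 := by
  refine le_antisymm ?_ ?_
  · exact antitoneOn_of_hasDerivWithinAt (convex_Ici 0) (f' := fun _ => 0) h (fun _ _ => le_rfl)
      Set.self_mem_Ici ht ht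
  · have := antitoneOn_of_hasDerivWithinAt (convex_Ici 0) (f := fun t => - f t) (f' := fun _ => 0)
      (fun t ht => by simpa only [neg_zero] using (h t ht).fun_neg) (fun _ _ => le_rfl) Set.self_mem_Ici ht ht
    simpa using this

namespace IsScaledSolution

variable {W : Matrix (Fin N) (Fin N) ℝ} {φ : ℝ → ℝ} {x : ℝ → Fin N → ℝ}

theorem continuousOn (h : IsScaledSolution W φ x) : ContinuousOn x (Set.Ici 0) :=
  fun t ht => (h.hasDeriv t ht).continuousWithinAt

theorem hasDeriv_apply (h : IsScaledSolution W φ x) {t : ℝ} (ht : 0 ≤ t) (i : Fin N) :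
    HasDerivWithinAt (fun t => x t i) (φ t * -(x t i ^ 2 * (W.mulVec (x t)) i)) (Set.Ici 0) t :=
  hasDerivWithinAt_pi.1 (h.hasDeriv t ht) i

theorem neg (h : IsScaledSolution W φ x) : IsScaledSolution W φ (fun t => -x t) where
  continuousOn_speed := h.continuousOn_speed
  speed_nonneg := h.speed_nonneg
  hasDeriv t ht := by
    refine (h.hasDeriv t ht).neg.congr_deriv ?_
    funext i
    simp [Matrix.mulVec_neg]

/-- Each coordinate is its initial value times a positive factor. -/
theorem exists_pos_factor (h : IsScaledSolution W φ x) (i : Fin N) {t : ℝ} (ht : 0 ≤ t) :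
    ∃ e : ℝ, 0 < e ∧ x t i = x 0 i * e := by
  set g : ℝ → ℝ := fun t => φ t * -(x t i * (W.mulVec (x t)) i) with hg
  have hgc : ContinuousOn g (Set.Ici 0) := by
    have h1 := h.continuousOn
    have h2 : ∀ j, ContinuousOn (fun t => x t j) (Set.Ici 0) := fun j =>
      (continuous_apply j).comp_continuousOn h1
    refine h.continuousOn_speed.mul (((h2 i).mul ?_).neg)
    unfold Matrix.mulVec dotProduct
    exact continuousOn_finsetSum _ fun j _ => continuousOn_const.mul (h2 j)
  -- Freezing `g` at negative times gives a globally continuous integrand. Its primitive `G` is the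
  -- integrating factor for `ẋᵢ = g xᵢ`.
  have hgc' : Continuous fun s => g (max 0 s) :=
    hgc.comp_continuous (by fun_prop) fun s => Set.mem_Ici.2 (le_max_left _ _)
  set G : ℝ → ℝ := fun t => ∫ s in (0 : ℝ)..t, g (max 0 s) with hG
  have hGd : ∀ t, 0 ≤ t → HasDerivWithinAt G (g t) (Set.Ici 0) t := fun t ht => by
    have := (hgc'.integral_hasStrictDerivAt 0 t).hasDerivAt.hasDerivWithinAt (s := Set.Ici 0)
    rwa [max_eq_right ht] at this
  have key := eq_of_hasDerivWithinAt_zero (f := fun t => x t i * Real.exp (-G t))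
    (fun t ht => by
      refine ((h.hasDeriv_apply ht i).mul (hGd t ht).neg.exp).congr_deriv ?_
      simp only [hg]
      ring) ht
  refine ⟨Real.exp (G t), Real.exp_pos _, ?_⟩
  have hG0 : G 0 = 0 := by simp [hG]
  simp only [hG0, neg_zero, Real.exp_zero, mul_one] at key
  rw [← key, mul_assoc, ← Real.exp_add]
  simp

open Matrix in
theorem hasDeriv_energy (hW : W.IsSymm) (h : IsScaledSolution W φ x) {t : ℝ} (ht : 0 ≤ t) :
    HasDerivWithinAt (fun t => energy W (x t))
      (-2 * φ t * ∑ i, (x t i * (W *ᵥ x t) i) ^ 2) (Set.Ici 0) t := by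
  set y : Fin N → ℝ := fun i => φ t * -(x t i ^ 2 * (W *ᵥ x t) i) with hy
  have h1 : ∀ i, HasDerivWithinAt (fun t => (W *ᵥ x t) i) ((W *ᵥ y) i) (Set.Ici 0) t := fun i => by
    unfold Matrix.mulVec dotProduct
    exact HasDerivWithinAt.fun_sum fun j _ => (h.hasDeriv_apply ht j).const_mul (W i j)
  have h2 : HasDerivWithinAt (fun t => energy W (x t))
      (∑ i, (y i * (W *ᵥ x t) i + x t i * (W *ᵥ y) i)) (Set.Ici 0) t := by
    unfold energy dotProduct
    exact HasDerivWithinAt.fun_sum fun i _ => (h.hasDeriv_apply ht i).mul (h1 i)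
  refine h2.congr_deriv ?_
  have h3 : x t ⬝ᵥ (W *ᵥ y) = y ⬝ᵥ (W *ᵥ x t) := by
    rw [dotProduct_mulVec, ← mulVec_transpose, hW.eq, dotProduct_comm]
  simp only [dotProduct] at h3
  rw [Finset.sum_add_distrib, h3, ← two_mul, Finset.mul_sum, Finset.mul_sum]
  refine Finset.sum_congr rfl fun i _ => ?_
  simp only [hy]
  ring

theorem antitoneOn_energy (hW : W.IsSymm) (h : IsScaledSolution W φ x) :
    AntitoneOn (fun t => energy W (x t)) (Set.Ici 0) := by
  refine antitoneOn_of_hasDerivWithinAt (convex_Ici 0) (fun t ht => h.hasDeriv_energy hW ht) ?_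
  intro t ht
  have := h.speed_nonneg t ht
  have h2 : 0 ≤ φ t * ∑ i, (x t i * (W.mulVec (x t)) i) ^ 2 := by positivity
  linarith

open Matrix in
theorem energy_sq_le (y : Fin N → ℝ) :
    energy W y ^ 2 ≤ N * ∑ i, (y i * (W *ᵥ y) i) ^ 2 := by
  have := sq_sum_le_card_mul_sum_sq (s := Finset.univ) (f := fun i => y i * (W *ᵥ y) i)
  simpa [energy, dotProduct] using this

theorem tendsto_energy [NeZero N] (hW : W.IsSymm) (hE : ∀ y, 0 ≤ energy W y)
    (h : IsScaledSolution W (fun _ => 1) x) :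
    Tendsto (fun t => energy W (x t)) atTop (𝓝 0) := by
  have hN : (0 : ℝ) < N := by exact_mod_cast Nat.pos_of_ne_zero (NeZero.ne N)
  have hanti := h.antitoneOn_energy hW
  have key : ∀ T, 0 < T → energy W (x T) ^ 2 ≤ N * energy W (x 0) / 2 * T⁻¹ := by
    intro T hT
    have hc : 0 ≤ 2 / N * energy W (x T) ^ 2 := by positivity
    -- On `[0, T]` the energy is at least its final value, so it falls at rate at least `2 E(T)² /
    -- N`; hence `E(T)² T` stays bounded.
    have := antitoneOn_of_hasDerivWithinAt (convex_Icc 0 T)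
      (f := fun t => energy W (x t) + (2 / N * energy W (x T) ^ 2) * t)
      (fun t ht => ((h.hasDeriv_energy hW ht.1).mono Set.Icc_subset_Ici_self).add
        ((hasDerivWithinAt_id t _).const_mul _)) (fun t ht => by
          have h1 := energy_sq_le (W := W) (x t)
          have h2 : energy W (x T) ≤ energy W (x t) := hanti ht.1 hT.le ht.2
          have h3 := pow_le_pow_left₀ (hE (x T)) h2 2
          have h4 : energy W (x T) ^ 2 / N ≤ ∑ i, (x t i * (W.mulVec (x t)) i) ^ 2 := by
            rw [div_le_iff₀ hN, mul_comm]
            exact h3.trans h1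
          have h5 : 2 / N * energy W (x T) ^ 2 = 2 * (energy W (x T) ^ 2 / N) := by ring
          rw [h5]
          linarith) (Set.left_mem_Icc.2 hT.le) (Set.right_mem_Icc.2 hT.le) hT.le
    have h0 := hE (x T)
    have h6 : 2 / N * energy W (x T) ^ 2 * T ≤ energy W (x 0) := by
      simp only [mul_zero, add_zero] at this
      linarith
    rw [← div_eq_mul_inv, le_div_iff₀ hT]
    have h7 : 2 / N * energy W (x T) ^ 2 * T = energy W (x T) ^ 2 * T * (2 / N) := by ring
    rw [h7, ← le_div_iff₀ (by positivity)] at h6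
    refine h6.trans (le_of_eq ?_)
    field_simp
  have hsq : Tendsto (fun t => energy W (x t) ^ 2) atTop (𝓝 0) := by
    refine tendsto_of_tendsto_of_tendsto_of_le_of_le' tendsto_const_nhds
      (by simpa using tendsto_inv_atTop_zero.const_mul (N * energy W (x 0) / 2))
      (Eventually.of_forall fun t => sq_nonneg _) ?_
    filter_upwards [eventually_gt_atTop 0] with T hT using key T hT
  have := hsq.sqrt
  simpa [Real.sqrt_sq (hE _)] using this

open Matrix in
/-- A first integral along solutions without zero coordinates. -/
theorem sum_div_eq (hW : W.IsSymm) {v : Fin N → ℝ} (hv : W *ᵥ v = 0)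
    (h : IsScaledSolution W φ x) (h0 : ∀ i, x 0 i ≠ 0) {t : ℝ} (ht : 0 ≤ t) :
    ∑ i, v i / x t i = ∑ i, v i / x 0 i := by
  refine eq_of_hasDerivWithinAt_zero (f := fun t => ∑ i, v i / x t i) (fun t ht => ?_) ht
  have hne : ∀ i, x t i ≠ 0 := fun i => by
    obtain ⟨e, he, hx⟩ := h.exists_pos_factor i ht
    rw [hx]
    exact mul_ne_zero (h0 i) he.ne'
  have h1 : HasDerivWithinAt (fun t => ∑ i, v i / x t i)
      (∑ i, v i * (φ t * (W *ᵥ x t) i)) (Set.Ici 0) t := by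
    refine HasDerivWithinAt.fun_sum fun i _ => ?_
    simp only [div_eq_mul_inv]
    -- The factor `xᵢ²` cancels: `1 / xᵢ` has derivative `φ (W x)ᵢ`, and `v` is orthogonal to the
    -- range of `W`.
    refine (((h.hasDeriv_apply ht i).fun_inv (hne i)).const_mul (v i)).congr_deriv ?_
    have := hne i
    field_simp
  refine h1.congr_deriv ?_
  have h3 : v ⬝ᵥ (W *ᵥ x t) = 0 := by
    rw [dotProduct_mulVec, ← mulVec_transpose, hW.eq, hv, zero_dotProduct]
  calc ∑ i, v i * (φ t * (W *ᵥ x t) i) = φ t * (v ⬝ᵥ (W *ᵥ x t)) := by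
        rw [dotProduct, Finset.mul_sum]
        exact Finset.sum_congr rfl fun i _ => by ring
    _ = 0 := by rw [h3, mul_zero]

end IsScaledSolution

/-! ### Interlacing with a multiple of the kernel vector. -/

theorem exists_interlacing_of_pos [NeZero N] {W : Matrix (Fin N) (Fin N) ℝ} (hW : W.IsSymm)
    {v : Fin N → ℝ} (hv0 : ∀ i, 0 < v i) (hv : W.mulVec v = 0) {x₀ : Fin N → ℝ}
    (hx₀ : ∀ i, 0 < x₀ i) :
    ∃ a : ℝ, 0 < a ∧ ∀ φ x, IsScaledSolution W φ x → x 0 = x₀ → ∀ t, 0 ≤ t →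
      (∃ i, x t i ≤ a * v i) ∧ ∃ j, a * v j ≤ x t j := by
  have hN : (0 : ℝ) < N := by exact_mod_cast Nat.pos_of_ne_zero (NeZero.ne N)
  have hc : 0 < ∑ i, v i / x₀ i :=
    Finset.sum_pos (fun i _ => div_pos (hv0 i) (hx₀ i)) Finset.univ_nonempty
  -- This is the `a` for which `a v` has the same first integral as `x₀`. A state strictly above or
  -- below `a v` in every coordinate would have a different value.
  refine ⟨N / ∑ i, v i / x₀ i, by positivity, fun φ x h h0 t ht => ?_⟩
  have hsum := h.sum_div_eq hW hv (fun i => by rw [h0]; exact (hx₀ i).ne') ht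
  rw [h0] at hsum
  set a := N / ∑ i, v i / x₀ i with ha
  have ha0 : 0 < a := by positivity
  have hxt : ∀ i, 0 < x t i := fun i => by
    obtain ⟨e, he, hx⟩ := h.exists_pos_factor i ht
    rw [hx, h0]
    exact mul_pos (hx₀ i) he
  have hconst : ∑ i : Fin N, 1 / a = ∑ i, v i / x t i := by
    rw [hsum, ha]
    simp
    field_simp
  constructor
  · by_contra! hlt
    refine absurd hconst.symm (ne_of_lt (Finset.sum_lt_sum_of_nonempty Finset.univ_nonempty ?_))
    intro i _
    rw [div_lt_div_iff₀ (hxt i) ha0]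
    linarith [hlt i]
  · by_contra! hlt
    refine absurd hconst (ne_of_lt (Finset.sum_lt_sum_of_nonempty Finset.univ_nonempty ?_))
    intro i _
    rw [div_lt_div_iff₀ ha0 (hxt i)]
    linarith [hlt i]

/-- Along all solutions from `x₀`, the state stays interlaced with one multiple of the kernel
vector `v`. -/
theorem exists_interlacing [NeZero N] {W : Matrix (Fin N) (Fin N) ℝ} (hW : W.IsSymm)
    {v : Fin N → ℝ} (hv0 : ∀ i, 0 < v i) (hv : W.mulVec v = 0) (x₀ : Fin N → ℝ) :
    ∃ a : ℝ, ((∀ i, 0 < x₀ i) → 0 < a) ∧ ((∀ i, x₀ i < 0) → a < 0) ∧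
      (¬ (∀ i, 0 < x₀ i) → ¬ (∀ i, x₀ i < 0) → a = 0) ∧
      ∀ φ x, IsScaledSolution W φ x → x 0 = x₀ → ∀ t, 0 ≤ t →
        (∃ i, x t i ≤ a * v i) ∧ ∃ j, a * v j ≤ x t j := by
  by_cases hp : ∀ i, 0 < x₀ i
  · obtain ⟨a, ha, H⟩ := exists_interlacing_of_pos hW hv0 hv hp
    exact ⟨a, fun _ => ha, fun hn => absurd (hp 0) (hn 0).le.not_gt, fun h => absurd hp h, H⟩
  by_cases hn : ∀ i, x₀ i < 0
  · obtain ⟨a, ha, H⟩ := exists_interlacing_of_pos hW hv0 hv (x₀ := -x₀)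
      (fun i => by simpa using hn i)
    refine ⟨-a, fun h => absurd h hp, fun _ => by linarith, fun _ h => absurd hn h, ?_⟩
    intro φ x h h0 t ht
    obtain ⟨⟨i, hi⟩, j, hj⟩ := H φ _ h.neg (by simp [h0]) t ht
    refine ⟨⟨j, ?_⟩, i, ?_⟩
    · simp only [Pi.neg_apply] at hj; linarith
    · simp only [Pi.neg_apply] at hi; linarith
  refine ⟨0, fun h => absurd h hp, fun h => absurd h hn, fun _ _ => rfl, ?_⟩
  intro φ x h h0 t ht
  push Not at hp hn
  obtain ⟨i, hi⟩ := hp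
  obtain ⟨j, hj⟩ := hn
  refine ⟨⟨i, ?_⟩, j, ?_⟩
  · obtain ⟨e, he, hx⟩ := h.exists_pos_factor i ht
    rw [hx, h0, zero_mul]
    exact mul_nonpos_of_nonpos_of_nonneg hi he.le
  · obtain ⟨e, he, hx⟩ := h.exists_pos_factor j ht
    rw [hx, h0, zero_mul]
    exact mul_nonneg hj he.le

/-! ### Coercivity of the energy on closed cones. -/

open Matrix in
theorem energy_smul (W : Matrix (Fin N) (Fin N) ℝ) (c : ℝ) (y : Fin N → ℝ) :
    energy W (c • y) = c ^ 2 * energy W y := by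
  simp only [energy, mulVec_smul, smul_dotProduct, dotProduct_smul, smul_eq_mul]
  ring

open Matrix in
theorem energy_sub_of_mulVec_eq_zero {W : Matrix (Fin N) (Fin N) ℝ} (hW : W.IsSymm)
    {u : Fin N → ℝ} (hu : W *ᵥ u = 0) (y : Fin N → ℝ) : energy W (y - u) = energy W y := by
  have h3 : u ⬝ᵥ (W *ᵥ y) = 0 := by
    rw [dotProduct_mulVec, ← mulVec_transpose, hW.eq, hu, zero_dotProduct]
  simp [energy, mulVec_sub, hu, sub_dotProduct, h3]

theorem continuous_energy (W : Matrix (Fin N) (Fin N) ℝ) : Continuous (energy W) := by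
  unfold energy Matrix.mulVec dotProduct
  fun_prop

/-- By homogeneity of degree two, `m` can be the minimum of the energy over the compact unit sphere
of the cone. -/
theorem exists_coercive {W : Matrix (Fin N) (Fin N) ℝ} {K : Set (Fin N → ℝ)} (hK : IsClosed K)
    (hcone : ∀ y ∈ K, ∀ c : ℝ, 0 < c → c • y ∈ K) (hpos : ∀ y ∈ K, y ≠ 0 → 0 < energy W y) :
    ∃ m : ℝ, 0 < m ∧ ∀ y ∈ K, m * ‖y‖ ^ 2 ≤ energy W y := by
  have hS : IsCompact (Metric.sphere (0 : Fin N → ℝ) 1 ∩ K) := (isCompact_sphere _ _).inter_right hK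
  have hmem : ∀ y ∈ K, y ≠ 0 → ‖y‖⁻¹ • y ∈ Metric.sphere (0 : Fin N → ℝ) 1 ∩ K := fun y hy hy0 =>
    ⟨by simp [norm_smul, hy0], hcone y hy _ (by positivity)⟩
  rcases (Metric.sphere (0 : Fin N → ℝ) 1 ∩ K).eq_empty_or_nonempty with he | hne
  · refine ⟨1, one_pos, fun y hy => ?_⟩
    by_cases hy0 : y = 0
    · simp [hy0, energy]
    · exact absurd (hmem y hy hy0) (by simp [he])
  · obtain ⟨z, hz, hmin⟩ := hS.exists_isMinOn hne (continuous_energy W).continuousOn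
    have hz0 : z ≠ 0 := by
      rintro rfl
      simp at hz
    refine ⟨energy W z, hpos z hz.2 hz0, fun y hy => ?_⟩
    by_cases hy0 : y = 0
    · simp [hy0, energy]
    · have h1 : energy W z ≤ energy W (‖y‖⁻¹ • y) := hmin (hmem y hy hy0)
      have h2 : 0 < ‖y‖ ^ 2 := by positivity
      rwa [energy_smul, inv_pow, inv_mul_eq_div, le_div_iff₀ h2] at h1

/-- The vectors with both a nonpositive and a nonnegative coordinate form a closed cone meeting the
line of `v` only at `0`. Interlacing puts `y - a v` in it, and subtracting `a v` does not change the
energy. -/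
theorem exists_coercive_of_kernel {W : Matrix (Fin N) (Fin N) ℝ} (hW : W.IsSymm)
    {v : Fin N → ℝ} (hv0 : ∀ i, 0 < v i) (hv : W.mulVec v = 0) (hE : ∀ y, 0 ≤ energy W y)
    (hker : ∀ y, energy W y = 0 → ∃ c : ℝ, y = c • v) :
    ∃ m : ℝ, 0 < m ∧ ∀ (a : ℝ) (y : Fin N → ℝ), (∃ i, y i ≤ a * v i) → (∃ j, a * v j ≤ y j) →
      m * ‖y - a • v‖ ^ 2 ≤ energy W y := by
  obtain ⟨m, hm, H⟩ := exists_coercive (W := W)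
    (K := (⋃ i, {y : Fin N → ℝ | y i ≤ 0}) ∩ ⋃ j, {y : Fin N → ℝ | 0 ≤ y j})
    ((isClosed_iUnion_of_finite fun i => isClosed_le (continuous_apply i) continuous_const).inter
      (isClosed_iUnion_of_finite fun i => isClosed_le continuous_const (continuous_apply i)))
    (by
      rintro y ⟨hy1, hy2⟩ c hc
      simp only [Set.mem_iUnion, Set.mem_ofPred_eq, Set.mem_inter_iff, Pi.smul_apply,
        smul_eq_mul] at hy1 hy2 ⊢
      obtain ⟨i, hi⟩ := hy1
      obtain ⟨j, hj⟩ := hy2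
      exact ⟨⟨i, mul_nonpos_of_nonneg_of_nonpos hc.le hi⟩, j, mul_nonneg hc.le hj⟩)
    (by
      rintro y ⟨hy1, hy2⟩ hy0
      simp only [Set.mem_iUnion, Set.mem_ofPred_eq] at hy1 hy2
      obtain ⟨i, hi⟩ := hy1
      obtain ⟨j, hj⟩ := hy2
      refine lt_of_le_of_ne (hE y) fun h => hy0 ?_
      obtain ⟨c, rfl⟩ := hker y h.symm
      have h1 : c ≤ 0 := nonpos_of_mul_nonpos_left hi (hv0 i)
      have h2 : 0 ≤ c := nonneg_of_mul_nonneg_left hj (hv0 j)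
      rw [le_antisymm h1 h2, zero_smul])
  refine ⟨m, hm, fun a y ⟨i, hi⟩ ⟨j, hj⟩ => ?_⟩
  rw [← energy_sub_of_mulVec_eq_zero hW (u := a • v) (by rw [Matrix.mulVec_smul, hv, smul_zero]) y]
  refine H _ ⟨Set.mem_iUnion.2 ⟨i, ?_⟩, Set.mem_iUnion.2 ⟨j, ?_⟩⟩ <;> simpa

theorem tendsto_of_coercive [NeZero N] {W : Matrix (Fin N) (Fin N) ℝ} (hW : W.IsSymm)
    (hE : ∀ y, 0 ≤ energy W y) {x : ℝ → Fin N → ℝ} (h : IsScaledSolution W (fun _ => 1) x)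
    {m : ℝ} (hm : 0 < m) {z : Fin N → ℝ} (hz : ∀ t, 0 ≤ t → m * ‖x t - z‖ ^ 2 ≤ energy W (x t)) :
    Tendsto x atTop (𝓝 z) := by
  rw [tendsto_iff_norm_sub_tendsto_zero]
  have hsq : Tendsto (fun t => ‖x t - z‖ ^ 2) atTop (𝓝 0) := by
    refine tendsto_of_tendsto_of_tendsto_of_le_of_le' tendsto_const_nhds
      (by simpa using (h.tendsto_energy hW hE).const_mul m⁻¹)
      (Eventually.of_forall fun t => sq_nonneg _) ?_
    filter_upwards [eventually_ge_atTop 0] with t ht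
    rw [inv_mul_eq_div, le_div_iff₀ hm, mul_comm]
    exact hz t ht
  simpa [Real.sqrt_sq (norm_nonneg _)] using hsq.sqrt

/-! ### Global existence by truncation and a priori bounds. -/

section

variable {E : Type*} [NormedAddCommGroup E] [NormedSpace ℝ E] {F : E → E} {K L : NNReal}

theorem exists_solution_Icc [CompleteSpace E] (hF : LipschitzWith K F) (hL : ∀ x, ‖F x‖ ≤ L)
    (x₀ : E) {T : ℝ} (hT : 0 ≤ T) :
    ∃ α : ℝ → E, α 0 = x₀ ∧ ∀ t ∈ Set.Icc 0 T,
      HasDerivWithinAt α (F (α t)) (Set.Icc 0 T) t := by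
  have hp : IsPicardLindelof (fun _ => F) (⟨0, le_rfl, hT⟩ : Set.Icc (0 : ℝ) T) x₀
      (L * T.toNNReal) 0 L K :=
    .of_time_independent (fun x _ => hL x) hF.lipschitzOnWith (by simp [hT])
  exact hp.exists_eq_forall_mem_Icc_hasDerivWithinAt₀

theorem solution_unique_Icc (hF : LipschitzWith K F) {α β : ℝ → E} {T T' s : ℝ} (h0 : α 0 = β 0)
    (hα : ∀ t ∈ Set.Icc 0 T, HasDerivWithinAt α (F (α t)) (Set.Icc 0 T) t)
    (hβ : ∀ t ∈ Set.Icc 0 T', HasDerivWithinAt β (F (β t)) (Set.Icc 0 T') t)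
    (hs : 0 ≤ s) (hT : s ≤ T) (hT' : s ≤ T') : α s = β s := by
  have hc : ∀ {γ : ℝ → E} {T : ℝ},
      (∀ t ∈ Set.Icc 0 T, HasDerivWithinAt γ (F (γ t)) (Set.Icc 0 T) t) → s ≤ T →
      ContinuousOn γ (Set.Icc 0 s) := fun hγ hT t ht =>
    (hγ t ⟨ht.1, ht.2.trans hT⟩).continuousWithinAt.mono (Set.Icc_subset_Icc_right hT)
  have hd : ∀ {γ : ℝ → E} {T : ℝ},
      (∀ t ∈ Set.Icc 0 T, HasDerivWithinAt γ (F (γ t)) (Set.Icc 0 T) t) → s ≤ T →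
      ∀ t ∈ Set.Ico 0 s, HasDerivWithinAt γ (F (γ t)) (Set.Ici t) t := fun hγ hT t ht =>
    (hγ t ⟨ht.1, ht.2.le.trans hT⟩).mono_of_mem_nhdsWithin
      (mem_of_superset (Icc_mem_nhdsGE (ht.2.trans_le hT)) (Set.Icc_subset_Icc_left ht.1))
  exact ODE_solution_unique_of_mem_Icc_right (v := fun _ => F) (s := fun _ => Set.univ) (K := K)
    (fun _ _ => hF.lipschitzOnWith) (hc hα hT) (hd hα hT) (fun _ _ => Set.mem_univ _)
    (hc hβ hT') (hd hβ hT') (fun _ _ => Set.mem_univ _) h0 ⟨hs, le_rfl⟩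

/-- Bounded Lipschitz autonomous vector fields have solutions on `[0, ∞)`. -/
theorem exists_global_solution [CompleteSpace E] (hF : LipschitzWith K F)
    (hL : ∀ x, ‖F x‖ ≤ L) (x₀ : E) :
    ∃ x : ℝ → E, x 0 = x₀ ∧ ∀ t, 0 ≤ t → HasDerivWithinAt x (F (x t)) (Set.Ici 0) t := by
  have hloc := fun n : ℕ => exists_solution_Icc hF hL x₀ (T := (n : ℝ) + 1) (by positivity)
  choose α hα0 hα using hloc
  -- The interval for `α n` ends at `n + 1`, beyond every `t` with floor `n`; uniqueness then
  -- identifies the glued function with `α ⌊t⌋₊` near `t`.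
  refine ⟨fun t => α ⌊t⌋₊ t, by simp [hα0], fun t ht => ?_⟩
  have hlt : t < ⌊t⌋₊ + 1 := Nat.lt_floor_add_one t
  have hmem : Set.Icc (0 : ℝ) (⌊t⌋₊ + 1) ∈ 𝓝[Set.Ici 0] t := by
    rw [← Set.Ici_inter_Iic]
    exact inter_mem_nhdsWithin _ (Iic_mem_nhds hlt)
  have hd := (hα ⌊t⌋₊ t ⟨ht, hlt.le⟩).mono_of_mem_nhdsWithin hmem
  refine HasDerivWithinAt.congr_of_eventuallyEq hd ?_ rfl
  filter_upwards [hmem] with s hs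
  exact solution_unique_Icc hF ((hα0 _).trans (hα0 _).symm) (hα _) (hα _) hs.1
    (Nat.lt_floor_add_one s).le hs.2

end

/-- An a priori bound that holds uniformly in the change of speed gives global solutions. -/
theorem exists_isScaledSolution_one {W : Matrix (Fin N) (Fin N) ℝ} {x₀ : Fin N → ℝ} {R : ℝ}
    (hR : ∀ φ x, IsScaledSolution W φ x → x 0 = x₀ → ∀ t, 0 ≤ t → ‖x t‖ ≤ R) :
    ∃ x, IsScaledSolution W (fun _ => 1) x ∧ x 0 = x₀ := by
  let f : ContDiffBump (0 : Fin N → ℝ) := ⟨max R 1, max R 1 + 1, by positivity, by linarith⟩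
  set F : (Fin N → ℝ) → (Fin N → ℝ) := fun y i => f y * -(y i ^ 2 * (W.mulVec y) i) with hF
  have hsmooth : ContDiff ℝ 1 F := by
    refine contDiff_pi.2 fun i => f.contDiff.mul ?_
    unfold Matrix.mulVec dotProduct
    fun_prop
  have hsupp : HasCompactSupport F := by
    refine f.hasCompactSupport.mono fun y hy => ?_
    contrapose! hy
    have : f y = 0 := by simpa using hy
    simp only [Function.mem_support, not_not, hF, this, zero_mul]
    rfl
  obtain ⟨K, hK⟩ := ContDiff.lipschitzWith_of_hasCompactSupport hsupp hsmooth one_ne_zero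
  obtain ⟨L, hL⟩ := hsupp.exists_bound_of_continuous hsmooth.continuous
  obtain ⟨x, hx0, hx⟩ := exists_global_solution hK (L := L.toNNReal)
    (fun y => (hL y).trans (Real.le_coe_toNNReal L)) x₀
  -- The cutoff along the trajectory is a change of speed, so `hR` applies to the truncated solution
  -- and confines it to the ball where `f = 1`.
  have hsol : IsScaledSolution W (fun t => f (x t)) x :=
    { continuousOn_speed := f.continuous.comp_continuousOn
        fun t ht => (hx t ht).continuousWithinAt
      speed_nonneg := fun t _ => f.nonneg
      hasDeriv := hx }
  refine ⟨x, ⟨continuousOn_const, fun _ _ => zero_le_one, fun t ht => ?_⟩, hx0⟩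
  have h1 : f (x t) = 1 := f.one_of_mem_closedBall <| by
    rw [mem_closedBall_zero_iff]
    exact (hR _ _ hsol hx0 t ht).trans (le_max_left _ _)
  simpa [hF, h1] using hsol.hasDeriv t ht

theorem bound_of_coercive {W : Matrix (Fin N) (Fin N) ℝ} (hW : W.IsSymm) {φ : ℝ → ℝ}
    {x : ℝ → Fin N → ℝ} (h : IsScaledSolution W φ x) {m : ℝ} (hm : 0 < m) {z : Fin N → ℝ}
    (hz : ∀ t, 0 ≤ t → m * ‖x t - z‖ ^ 2 ≤ energy W (x t)) {t : ℝ} (ht : 0 ≤ t) :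
    ‖x t‖ ≤ √(energy W (x 0) / m) + ‖z‖ := by
  have h1 : m * ‖x t - z‖ ^ 2 ≤ energy W (x 0) :=
    (hz t ht).trans (h.antitoneOn_energy hW Set.self_mem_Ici ht ht)
  have h2 : ‖x t - z‖ ≤ √(energy W (x 0) / m) := by
    refine Real.le_sqrt_of_sq_le ?_
    rwa [le_div_iff₀ hm, mul_comm]
  have h3 := norm_le_norm_add_norm_sub z (x t)
  rw [norm_sub_rev] at h3
  linarith

/-! ### Application to the opinion dynamics. -/

open Matrix in
theorem isSolution_iff {B W : Matrix (Fin N) (Fin N) ℝ} {σ : Fin N → ℝ}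
    (hW : W = diagonal σ - B) {x : ℝ → Fin N → ℝ} :
    IsSolution B σ x ↔ IsScaledSolution W (fun _ => 1) x := by
  have hfield : ∀ y : Fin N → ℝ, opinionField stubbornNeutrals B σ y
      = fun i => 1 * -(y i ^ 2 * (W *ᵥ y) i) := fun y => by
    funext i
    have h : (W *ᵥ y) i = σ i * y i - ∑ j, B i j * y j := by
      rw [hW, sub_mulVec, Pi.sub_apply, mulVec_diagonal]
      rfl
    simp only [opinionField, stubbornNeutrals, h]
    ring
  constructor
  · intro h
    exact ⟨continuousOn_const, fun _ _ => zero_le_one, fun t ht => hfield (x t) ▸ h t ht⟩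
  · intro h t ht
    rw [hfield]
    exact h.hasDeriv t ht

open Matrix in
theorem energy_smul_one_sub (M : Matrix (Fin N) (Fin N) ℝ) (s : ℝ) (y : Fin N → ℝ) :
    energy (s • (1 : Matrix (Fin N) (Fin N) ℝ) - M) y = s * (y ⬝ᵥ y) - y ⬝ᵥ (M *ᵥ y) := by
  simp [energy, sub_mulVec, smul_mulVec, dotProduct_sub]

section

variable {B M : Matrix (Fin N) (Fin N) ℝ} {σ : Fin N → ℝ} {s : ℝ}

theorem isSymm_smul_one_sub (hM : M.IsSymm) :
    (s • (1 : Matrix (Fin N) (Fin N) ℝ) - M).IsSymm := by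
  simp [Matrix.IsSymm, Matrix.transpose_sub, hM.eq]

theorem energy_nonneg_of_rho_le (hM : M.IsSymm) (hs : rho M ≤ s) (y : Fin N → ℝ) :
    0 ≤ energy (s • (1 : Matrix (Fin N) (Fin N) ℝ) - M) y := by
  rw [energy_smul_one_sub]
  have h1 := dotProduct_mulVec_le hM y
  have h2 : 0 ≤ y ⬝ᵥ y := Finset.sum_nonneg fun i _ => mul_self_nonneg _
  nlinarith

theorem exists_coercive_of_rho_lt (hM : M.IsSymm) (hs : rho M < s) :
    ∃ m : ℝ, 0 < m ∧ ∀ y, m * ‖y‖ ^ 2 ≤ energy (s • (1 : Matrix (Fin N) (Fin N) ℝ) - M) y := by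
  obtain ⟨m, hm, H⟩ := exists_coercive (W := s • (1 : Matrix (Fin N) (Fin N) ℝ) - M)
    isClosed_univ (fun _ _ _ _ => Set.mem_univ _) (fun y _ hy => by
      rw [energy_smul_one_sub]
      have h1 := dotProduct_mulVec_le hM y
      have h2 : 0 ≤ y ⬝ᵥ y := Finset.sum_nonneg fun i _ => mul_self_nonneg _
      have h3 : y ⬝ᵥ y ≠ 0 := fun h => hy (dotProduct_self_eq_zero.1 h)
      have h4 : 0 < y ⬝ᵥ y := lt_of_le_of_ne h2 h3.symm
      nlinarith)
  exact ⟨m, hm, fun y => H y (Set.mem_univ y)⟩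

open Matrix in
theorem IsRightPositiveEigenvector.mulVec_eq_zero {v : Fin N → ℝ}
    (hv : IsRightPositiveEigenvector M v) :
    (rho M • (1 : Matrix (Fin N) (Fin N) ℝ) - M) *ᵥ v = 0 := by
  simp [sub_mulVec, smul_mulVec, hv.2]

theorem IsRightPositiveEigenvector.exists_coercive [NeZero N] (hM : M.IsSymm) (hpos : EventuallyPositive M)
    {v : Fin N → ℝ} (hv : IsRightPositiveEigenvector M v) :
    ∃ m : ℝ, 0 < m ∧ ∀ (a : ℝ) (y : Fin N → ℝ), (∃ i, y i ≤ a * v i) → (∃ j, a * v j ≤ y j) →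
      m * ‖y - a • v‖ ^ 2 ≤ energy (rho M • (1 : Matrix (Fin N) (Fin N) ℝ) - M) y := by
  refine exists_coercive_of_kernel (isSymm_smul_one_sub hM) hv.1 hv.mulVec_eq_zero
    (energy_nonneg_of_rho_le hM le_rfl) fun y hy => ?_
  rw [energy_smul_one_sub, sub_eq_zero] at hy
  exact hv.eq_smul hpos (mulVec_eq_of_dotProduct_mulVec_eq hM hy.symm)

theorem solutionsExist [NeZero N] (hM : M.IsSymm) (hpos : EventuallyPositive M) (hs : rho M ≤ s)
    (hB : s • (1 : Matrix (Fin N) (Fin N) ℝ) - M = Matrix.diagonal σ - B) :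
    SolutionsExist B σ := by
  intro x₀ _
  simp only [isSolution_iff hB]
  have hW : (s • (1 : Matrix (Fin N) (Fin N) ℝ) - M).IsSymm := isSymm_smul_one_sub hM
  rcases hs.lt_or_eq with hlt | rfl
  · obtain ⟨m, hm, H⟩ := exists_coercive_of_rho_lt hM hlt
    refine exists_isScaledSolution_one (R := √(energy (s • 1 - M) x₀ / m) + ‖(0 : Fin N → ℝ)‖) fun φ x h h0 t ht => ?_
    have := bound_of_coercive hW h hm (z := 0) (fun t _ => by simpa using H (x t)) ht
    rwa [h0] at this
  · obtain ⟨v, hv⟩ := exists_isRightPositiveEigenvector hM hpos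
    obtain ⟨m, hm, H⟩ := hv.exists_coercive hM hpos
    obtain ⟨a, -, -, -, ha⟩ := exists_interlacing hW hv.1 hv.mulVec_eq_zero x₀
    refine exists_isScaledSolution_one (R := √(energy (rho M • 1 - M) x₀ / m) + ‖a • v‖) fun φ x h h0 t ht => ?_
    have := bound_of_coercive hW h hm (z := a • v)
      (fun t ht => H a (x t) (ha φ x h h0 t ht).1 (ha φ x h h0 t ht).2) ht
    rwa [h0] at this

theorem convergesToZero_of_rho_lt [NeZero N] (hM : M.IsSymm) (hs : rho M < s)
    (hB : s • (1 : Matrix (Fin N) (Fin N) ℝ) - M = Matrix.diagonal σ - B) :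
    ConvergesToZero B σ := by
  intro x hx _
  obtain ⟨m, hm, H⟩ := exists_coercive_of_rho_lt hM hs
  exact tendsto_of_coercive (isSymm_smul_one_sub hM) (energy_nonneg_of_rho_le hM hs.le)
    ((isSolution_iff hB).1 hx) hm fun t _ => by simpa using H (x t)

theorem norm_le_one_of_tendsto {x : ℝ → Fin N → ℝ} {z : Fin N → ℝ}
    (hx : Tendsto x atTop (𝓝 z)) (hcube : ∀ t, 0 ≤ t → x t ∈ cube N) : ‖z‖ ≤ 1 := by
  refine le_of_tendsto hx.norm ?_
  filter_upwards [eventually_ge_atTop 0] with t ht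
  exact (pi_norm_le_iff_of_nonneg zero_le_one).2 fun i => abs_le.2 (hcube t ht i)

theorem convergesToMultiples_of_eq_rho [NeZero N] (hM : M.IsSymm) (hpos : EventuallyPositive M)
    (hB : rho M • (1 : Matrix (Fin N) (Fin N) ℝ) - M = Matrix.diagonal σ - B)
    {v : Fin N → ℝ} (hv : IsRightPositiveEigenvector M v) : ConvergesToMultiples B σ v := by
  intro x hx _
  have h := (isSolution_iff hB).1 hx
  have hW : (rho M • (1 : Matrix (Fin N) (Fin N) ℝ) - M).IsSymm := isSymm_smul_one_sub hM
  obtain ⟨m, hm, H⟩ := hv.exists_coercive hM hpos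
  obtain ⟨a, hap, han, ha0, ha⟩ := exists_interlacing hW hv.1 hv.mulVec_eq_zero (x 0)
  have hlim : Tendsto x atTop (𝓝 (a • v)) :=
    tendsto_of_coercive hW (energy_nonneg_of_rho_le hM le_rfl) h hm fun t ht =>
      H a (x t) (ha _ x h rfl t ht).1 (ha _ x h rfl t ht).2
  have hvn : 0 < ‖v‖ := norm_pos_iff.2 fun h0 => by simpa [h0] using hv.1 0
  have hbound : (∀ t : ℝ, 0 ≤ t → x t ∈ cube N) → |a| ≤ 1 / ‖v‖ := fun hc => by
    rw [le_div_iff₀ hvn, ← Real.norm_eq_abs, ← norm_smul]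
    exact norm_le_one_of_tendsto hlim hc
  exact ⟨fun hp => ⟨a, hap hp, fun hc => (abs_le.1 (hbound hc)).2, hlim⟩,
    fun hn => ⟨a, han hn, fun hc => (abs_le.1 (hbound hc)).1, hlim⟩,
    fun hp hn => by simpa [ha0 hp hn] using hlim⟩

end

end OpinionDynamics

theorem corollary2 {N : ℕ} (hN : 0 < N) (B : Matrix (Fin N) (Fin N) ℝ) (σ : Fin N → ℝ)
    (hdiag : ∀ i, B i i = 0) (hσ : ∀ i, 0 < σ i) (hundirected : B.IsSymm) :
    (OpinionDynamics.Assumption1 B σ →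
      OpinionDynamics.SolutionsExist B σ ∧
      (∃ v, OpinionDynamics.IsRightPositiveEigenvector B v) ∧
      ((∀ i, σ i = OpinionDynamics.rho B) →
        ∀ v, OpinionDynamics.IsRightPositiveEigenvector B v →
          OpinionDynamics.ConvergesToMultiples B σ v) ∧
      ((∀ i, OpinionDynamics.rho B < σ i) → OpinionDynamics.ConvergesToZero B σ)) ∧
    (∀ d : ℝ, OpinionDynamics.Assumption2 B σ d →
      OpinionDynamics.SolutionsExist B σ ∧
      (∃ v, OpinionDynamics.IsRightPositiveEigenvector (OpinionDynamics.shifted B σ d) v) ∧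
      (d = OpinionDynamics.rho (OpinionDynamics.shifted B σ d) →
        ∀ v, OpinionDynamics.IsRightPositiveEigenvector (OpinionDynamics.shifted B σ d) v →
          OpinionDynamics.ConvergesToMultiples B σ v) ∧
      (OpinionDynamics.rho (OpinionDynamics.shifted B σ d) < d →
        OpinionDynamics.ConvergesToZero B σ)) := by
  open OpinionDynamics in
  have : NeZero N := ⟨hN.ne'⟩
  refine ⟨fun ⟨hpos, hconst, hle⟩ => ?_, fun d ⟨_, hpos, hle⟩ => ?_⟩
  -- Leaving `s` free allows both `s = σ 0` and, in the critical case, `s = rho B`.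
  · have hB : ∀ s, s = σ 0 →
        s • (1 : Matrix (Fin N) (Fin N) ℝ) - B = Matrix.diagonal σ - B := by
      rintro s rfl
      rw [Matrix.smul_one_eq_diagonal]
      congr 2
      exact funext fun i => hconst 0 i
    refine ⟨solutionsExist hundirected hpos (hle 0) (hB _ rfl),
      exists_isRightPositiveEigenvector hundirected hpos,
      fun h v hv => convergesToMultiples_of_eq_rho hundirected hpos (hB _ (h 0).symm) hv,
      fun h => convergesToZero_of_rho_lt hundirected (h 0) (hB _ rfl)⟩
  · have hB : d • (1 : Matrix (Fin N) (Fin N) ℝ) - shifted B σ d = Matrix.diagonal σ - B := by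
      rw [shifted]
      abel
    have hsymm : (shifted B σ d).IsSymm := by
      simp [shifted, Matrix.IsSymm, Matrix.transpose_add, Matrix.transpose_sub, hundirected.eq]
    refine ⟨solutionsExist hsymm hpos hle hB, exists_isRightPositiveEigenvector hsymm hpos,
      fun h v hv => convergesToMultiples_of_eq_rho hsymm hpos (h ▸ hB) hv,
      fun h => convergesToZero_of_rho_lt hsymm h hB⟩
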